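/- Let $A$ be a finite set, let $(\mu_n)_{n\in\mathbb Z}$ be probability measures on $A$, put $X=A^{\mathbb Z}$ and $\mu=\bigotimes_{n\in\mathbb Z}\mu_n$, and let $T$ be the shift on $X$, $(Tx)_n=x_{n-1}$. Suppose that $T$ is nonsingular, i.e. $\mu\circ T$ and $\mu$ have the same null sets, and that $$\delta:=\inf_{n>0}\ \min_{a\in A}\mu_n(a)>0$$ (no bound is assumed along $n\le 0$). A nonsingular invertible transformation $S$ of a probability space $(Z,\kappa)$ is called *conservative* if for every measurable $B$ with $\kappa(B)>0$ there are $x\in B$ and $m\ge 1$ with $S^m x\in B$ (there is no wandering set of positive measure), and *weakly mixing* if for every ergodic measure preserving invertible transformation $R$ of a standard probability space $(Y,\nu)$, the product $S\times R$ is ergodic on $(Z\times Y,\kappa\otimes\nu)$, i.e. every measurable $(S\times R)$-invariant set is null or conull. (1) If $T$ is conservative on $(X,\mu)$, then $T$ is weakly mixing. (2) For every integer $p>1$: if the $p$-fold product $T\times\cdots\times T$ is conservative on $(X^p,\mu^{\otimes p})$, then $T\times\cdots\times T$ ($p$ times) is weakly mixing. -/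

import Mathlib

open MeasureTheory

noncomputable section

/-- The left shift `T` on `A^ℤ`, `(T x)_n = x_{n-1}`. It generates the shift action of `ℤ`,
`(T_g x)_n = x_{n-g}`. -/
def leftShift (A : Type*) [MeasurableSpace A] : (ℤ → A) ≃ᵐ (ℤ → A) where
  toFun x n := x (n - 1)
  invFun x n := x (n + 1)
  left_inv x := by funext n; simp
  right_inv x := by funext n; simp
  measurable_toFun := measurable_pi_lambda _ fun n => measurable_pi_apply (n - 1)
  measurable_invFun := measurable_pi_lambda _ fun n => measurable_pi_apply (n + 1)

/-- The `p`-fold Cartesian product `T × ⋯ × T`, acting on `X^p`. -/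
def cartesianPower {X : Type*} [MeasurableSpace X] (p : ℕ) (T : X ≃ᵐ X) :
    (Fin p → X) ≃ᵐ (Fin p → X) :=
  MeasurableEquiv.piCongrRight fun _ => T

/-- An invertible transformation `T` is nonsingular for `μ` if the image of `μ` under `T` and `μ`
have the same null sets; then so do `μ ∘ T^g` and `μ` for every integer `g`. -/
def IsNonsingular {X : Type*} [MeasurableSpace X] (T : X ≃ᵐ X) (μ : Measure X) : Prop :=
  μ.map T ≪ μ ∧ μ ≪ μ.map T

/-- A nonsingular invertible transformation `T` of `(X, μ)` is weakly mixing if `T × R` is ergodic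
for every ergodic probability preserving invertible transformation `R` of a standard probability
space `(Y, ν)`. Every standard Borel space is isomorphic to one in `Type`, so it suffices
to let `Y` range over `Type`. The product is in general only nonsingular, so its ergodicity
is the predicate `QuasiErgodic`. -/
def IsWeaklyMixing {X : Type*} [MeasurableSpace X] (T : X ≃ᵐ X) (μ : Measure X) : Prop :=
  IsNonsingular T μ ∧
    ∀ (Y : Type) [MeasurableSpace Y] [StandardBorelSpace Y] (ν : Measure Y)
      [IsProbabilityMeasure ν] (R : Y ≃ᵐ Y),
      Ergodic R ν → QuasiErgodic (T.prodCongr R) (μ.prod ν)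

end

/-!
The proof is Hopf's argument for the product `S = T × R` on `(ℤ → A) × Y`, with the ratio ergodic
theorem replaced by a maximal inequality.

Let `D_k` be the density of `m ∘ S^k` with respect to the product measure `m`; it is the cocycle
`∏_{i < k} D (S^i z)`, and it does not depend on the point of `Y`, because `R` preserves its
measure. As `T` is conservative, `∑ D_k = ∞` almost everywhere (`tsum_cocycle_eq_top`).
Let `σ` exchange two symbols at the coordinate `n`. Since `T^k σ_n = σ_{n+k} T^k`, and since
`σ_{n+k}` distorts the measure at most by the factor `δ⁻¹` once `n + k > 0`, the ratio
`D_k (σ z) / D_k z` stays between two positive constants (`cocycle_comp_le`); this is where the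
lower bound `δ` is needed. Moreover `S^k z` and `S^k (σ z)` eventually agree on each cylinder. Hence a
set `B` with `S⁻¹ B = B` is `σ`-invariant mod `0` (`preimage_ae_eq_of_invariant`): approximate `B`
by a cylinder set `C`; by the Hopf maximal inequality (`maximal_inequality`), outside a small set
the `D_k`-weighted proportion of times `k` at which `S^k z` lies in the symmetric difference of `B`
and `C` is uniformly small; but for `z ∈ B`, `σ z ∉ B` the two orbits have comparable weights and
visit `C` at the same times, so this proportion cannot be small for both of them.

Almost every fibre `B_y ⊆ (ℤ → A)` is therefore invariant under changes of finitely many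
coordinates, and has measure `0` or `1` by a zero-one law (`infinitePi_eq_zero_or_one`). The points
`y` with a null fibre form an `R`-invariant set, and ergodicity of `R` concludes.

The case of a Cartesian power reduces to that of a single shift: the `p`-th power of the shift
on `A^ℤ` is conjugate to the shift on `(A^p)^ℤ`, whose marginals satisfy the same kind of bound.
-/

open Filter Topology Set
open scoped ENNReal NNReal symmDiff

namespace HopfArgument

variable {Z : Type*}

/-! ### Weighted orbit sums and the Hopf maximal inequality -/

/-- The multiplicative cocycle `∏_{i < k} D (S^i z)`. When `D` is the density of `m ∘ S` with
respect to `m`, this is the density of `m ∘ S^k`. -/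
noncomputable def cocycle (S : Z → Z) (D : Z → ℝ≥0) (k : ℕ) (z : Z) : ℝ≥0 :=
  ∏ i ∈ Finset.range k, D (S^[i] z)

/-- The sum of `q` over the first `n` points of the orbit of `z`, weighted by the cocycle. -/
noncomputable def orbitSum (S : Z → Z) (D : Z → ℝ≥0) (q : Z → ℝ≥0∞) (n : ℕ) (z : Z) : ℝ≥0∞ :=
  ∑ k ∈ Finset.range n, (cocycle S D k z : ℝ≥0∞) * q (S^[k] z)

/-- The truncated maximal function of `q - l`, given by `M₀ = 0` and
`M_{n+1} = (q + D · (M_n ∘ S) - l)⁺`. Truncated subtraction takes the positive part. -/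
noncomputable def maxFun (S : Z → Z) (D : Z → ℝ≥0) (q : Z → ℝ≥0∞) (l : ℝ≥0) : ℕ → Z → ℝ≥0∞
  | 0, _ => 0
  | n + 1, z => q z + D z * maxFun S D q l n (S z) - l

lemma cocycle_succ (S : Z → Z) (D : Z → ℝ≥0) (k : ℕ) (z : Z) :
    cocycle S D (k + 1) z = D z * cocycle S D k (S z) := by
  simp [cocycle, Finset.prod_range_succ', mul_comm]

lemma orbitSum_succ (S : Z → Z) (D : Z → ℝ≥0) (q : Z → ℝ≥0∞) (n : ℕ) (z : Z) :
    orbitSum S D q (n + 1) z = q z + D z * orbitSum S D q n (S z) := by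
  simp only [orbitSum, Finset.sum_range_succ', cocycle_succ, Finset.mul_sum]
  rw [add_comm]
  congr 1
  · simp [cocycle]
  · refine Finset.sum_congr rfl fun k _ => ?_
    simp [mul_assoc]

lemma orbitSum_le_maxFun (S : Z → Z) (D : Z → ℝ≥0) (q : Z → ℝ≥0∞) (l : ℝ≥0) (n : ℕ) (z : Z) :
    orbitSum S D q n z ≤ l * orbitSum S D 1 n z + maxFun S D q l n z := by
  induction n generalizing z with
  | zero => simp [orbitSum]
  | succ n ih =>
    rw [orbitSum_succ, orbitSum_succ, maxFun]
    calc q z + D z * orbitSum S D q n (S z)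
        ≤ q z + D z * (l * orbitSum S D 1 n (S z) + maxFun S D q l n (S z)) := by
          gcongr; exact ih _
      _ = l * (D z * orbitSum S D 1 n (S z)) + (q z + D z * maxFun S D q l n (S z)) := by ring
      _ ≤ l * (D z * orbitSum S D 1 n (S z)) +
            ((q z + D z * maxFun S D q l n (S z) - l) + l) := by
          exact add_le_add le_rfl le_tsub_add
      _ = _ := by simp only [Pi.one_apply]; ring

lemma maxFun_le_succ (S : Z → Z) (D : Z → ℝ≥0) (q : Z → ℝ≥0∞) (l : ℝ≥0) (n : ℕ) (z : Z) :
    maxFun S D q l n z ≤ maxFun S D q l (n + 1) z := by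
  induction n generalizing z with
  | zero => simp [maxFun]
  | succ n ih =>
    rw [maxFun, maxFun]
    gcongr
    exact ih _

variable [MeasurableSpace Z] {m : Measure Z} {S : Z ≃ᵐ Z} {D : Z → ℝ≥0}

@[fun_prop]
lemma measurable_cocycle (hDm : Measurable D) (k : ℕ) : Measurable (cocycle S D k) := by
  unfold cocycle
  exact Finset.measurable_prod _ fun i _ => hDm.comp (S.measurable.iterate i)

lemma measurable_maxFun (hDm : Measurable D) {q : Z → ℝ≥0∞} (hq : Measurable q) (l : ℝ≥0)
    (n : ℕ) : Measurable (maxFun S D q l n) := by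
  induction n with
  | zero => exact measurable_const
  | succ n ih =>
    have : Measurable fun z => maxFun S D q l n (S z) := ih.comp S.measurable
    show Measurable fun z => q z + D z * maxFun S D q l n (S z) - l
    fun_prop

lemma lintegral_density_mul_comp (hDm : Measurable D)
    (hD : m.map S.symm = m.withDensity fun z => D z) {f : Z → ℝ≥0∞} (hf : Measurable f) :
    ∫⁻ z, D z * f (S z) ∂m = ∫⁻ z, f z ∂m := by
  have h := lintegral_withDensity_eq_lintegral_mul m (measurable_coe_nnreal_ennreal.comp hDm)
    (hf.comp S.measurable)
  simp only [Function.comp_def, Pi.mul_apply] at h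
  have hfS : Measurable fun z => f (S z) := hf.comp S.measurable
  rw [← h, ← hD, lintegral_map hfS S.symm.measurable]
  simp

lemma lintegral_cocycle_mul_comp (hDm : Measurable D)
    (hD : m.map S.symm = m.withDensity fun z => D z) (k : ℕ) {f : Z → ℝ≥0∞}
    (hf : Measurable f) : ∫⁻ z, cocycle S D k z * f (S^[k] z) ∂m = ∫⁻ z, f z ∂m := by
  induction k with
  | zero => simp [cocycle]
  | succ k ih =>
    have hg : Measurable fun z => (cocycle S D k z : ℝ≥0∞) * f (S^[k] z) :=
      ((measurable_cocycle hDm k).coe_nnreal_ennreal).mul (hf.comp (S.measurable.iterate k))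
    rw [← ih, ← lintegral_density_mul_comp hDm hD hg]
    simp [cocycle_succ, mul_assoc]

lemma symm_iterate_iterate (S : Z ≃ᵐ Z) (k : ℕ) (z : Z) : S.symm^[k] (S^[k] z) = z :=
  Function.LeftInverse.iterate (f := S) (g := S.symm) S.symm_apply_apply k z

lemma setLIntegral_cocycle (hDm : Measurable D)
    (hD : m.map S.symm = m.withDensity fun z => D z) (k : ℕ) {E : Set Z} (hE : MeasurableSet E) :
    ∫⁻ z in E, cocycle S D k z ∂m = m (S.symm^[k] ⁻¹' E) := by
  have hE' := S.symm.measurable.iterate k hE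
  rw [← lintegral_indicator_one hE',
    ← lintegral_cocycle_mul_comp (S := S) hDm hD k (measurable_one.indicator hE'),
    ← lintegral_indicator hE]
  congr with z
  by_cases hz : z ∈ E <;> simp [hz, indicator, symm_iterate_iterate]

/-- The **Hopf maximal inequality** for the positive contraction `f ↦ D · (f ∘ S)` of `L¹`,
applied to an indicator function. -/
theorem maximal_inequality [IsFiniteMeasure m] (hDm : Measurable D)
    (hD : m.map S.symm = m.withDensity fun z => D z) {Q : Set Z} (hQ : MeasurableSet Q)
    (l : ℝ≥0) :
    l * m {z | ∃ n, l * orbitSum S D 1 n z < orbitSum S D (Q.indicator 1) n z} ≤ m Q := by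
  set q : Z → ℝ≥0∞ := Q.indicator 1 with hq
  have hqm : Measurable q := measurable_one.indicator hQ
  set M := maxFun S D q l with hM
  have hMm : ∀ n, Measurable (M n) := measurable_maxFun hDm hqm l
  have hint : ∀ n, ∫⁻ z, (q z + D z * M n (S z)) ∂m = m Q + ∫⁻ z, M n z ∂m := by
    intro n
    rw [lintegral_add_left hqm, lintegral_density_mul_comp hDm hD (hMm n), hq,
      lintegral_indicator_one hQ]
  have hfin : ∀ n, ∫⁻ z, M n z ∂m ≠ ∞ := by
    intro n
    induction n with
    | zero => simp [hM, maxFun]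
    | succ n ih =>
      refine ne_top_of_le_ne_top (b := m Q + ∫⁻ z, M n z ∂m) (by finiteness) ?_
      rw [← hint]
      exact lintegral_mono fun z => tsub_le_self
  have hsub : {z | ∃ n, l * orbitSum S D 1 n z < orbitSum S D q n z} ⊆
      ⋃ n, {z | 0 < M n z} := by
    rintro z ⟨n, hn⟩
    refine mem_iUnion.2 ⟨n, ?_⟩
    by_contra h
    have h0 : M n z = 0 := by simpa using h
    have := orbitSum_le_maxFun S D q l n z
    rw [← hM, h0, add_zero] at this
    exact absurd hn this.not_gt
  have hmono : Monotone fun n => {z | 0 < M n z} := monotone_nat_of_le_succ fun n z hz =>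
    lt_of_lt_of_le hz (maxFun_le_succ S D q l n z)
  have hE : ∀ n, l * m {z | 0 < M n z} ≤ m Q := by
    intro n
    cases n with
    | zero => simp [hM, maxFun]
    | succ n =>
      have hEm : MeasurableSet {z | 0 < M (n + 1) z} :=
        measurableSet_lt measurable_const (hMm _)
      have h1 : ∫⁻ z, M (n + 1) z ∂m + l * m {z | 0 < M (n + 1) z} ≤
          ∫⁻ z, M (n + 1) z ∂m + m Q := by
        calc ∫⁻ z, M (n + 1) z ∂m + l * m {z | 0 < M (n + 1) z}
            = ∫⁻ z, M (n + 1) z + {z | 0 < M (n + 1) z}.indicator (fun _ => (l : ℝ≥0∞)) z ∂m := by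
              rw [lintegral_add_left (hMm _), lintegral_indicator_const hEm]
          _ ≤ ∫⁻ z, (q z + D z * M n (S z)) ∂m := by
              refine lintegral_mono fun z => ?_
              by_cases hz : 0 < M (n + 1) z
              · have : M (n + 1) z = q z + D z * M n (S z) - l := rfl
                rw [this] at hz
                simp only [indicator, mem_ofPred_eq, this, hz, if_true]
                exact (tsub_add_cancel_of_le (tsub_pos_iff_lt.1 hz).le).le
              · have : M (n + 1) z = 0 := by simpa using hz
                simp [indicator, this]
          _ = m Q + ∫⁻ z, M n z ∂m := hint n
          _ ≤ m Q + ∫⁻ z, M (n + 1) z ∂m := by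
              gcongr; exact maxFun_le_succ S D q l n _
          _ = _ := add_comm _ _
      exact (ENNReal.add_le_add_iff_left (hfin _)).1 h1
  calc l * m {z | ∃ n, l * orbitSum S D 1 n z < orbitSum S D q n z}
      ≤ l * m (⋃ n, {z | 0 < M n z}) := by gcongr
    _ = ⨆ n, l * m {z | 0 < M n z} := by rw [hmono.measure_iUnion, ENNReal.mul_iSup]
    _ ≤ m Q := iSup_le hE

/-! ### Conservativity and divergence of the cocycle -/

lemma conservative_symm (hS : Conservative S m) (h : m.map S.symm ≪ m) :
    Conservative S.symm m where
  measurable := S.symm.measurable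
  absolutelyContinuous := h
  exists_mem_iterate_mem' := by
    intro s hs h0
    obtain ⟨x, hx, n, hn, hxn⟩ := hS.exists_mem_iterate_mem' hs h0
    exact ⟨S^[n] x, hxn, n, hn, by rwa [symm_iterate_iterate]⟩

/-- A set `E` of positive measure on which `∑ₖ Dₖ` is bounded would satisfy
`∑ₖ m (S^k E) < ∞`, so by Borel-Cantelli almost no backward orbit could return to `E` infinitely
often. -/
theorem tsum_cocycle_eq_top [IsFiniteMeasure m] (hDm : Measurable D)
    (hD : m.map S.symm = m.withDensity fun z => D z) (hS : Conservative S m) :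
    ∀ᵐ z ∂m, ∑' k, (cocycle S D k z : ℝ≥0∞) = ∞ := by
  have hcons : Conservative S.symm m :=
    conservative_symm hS (hD ▸ withDensity_absolutelyContinuous _ _)
  set F : Z → ℝ≥0∞ := fun z => ∑' k, (cocycle S D k z : ℝ≥0∞) with hF
  have hFm : Measurable F := Measurable.tsum fun k =>
    (measurable_cocycle hDm k).coe_nnreal_ennreal
  have key : ∀ N : ℕ, m {z | F z ≤ N} = 0 := by
    intro N
    have hE : MeasurableSet {z | F z ≤ N} := measurableSet_le hFm measurable_const
    set E := {z | F z ≤ N}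
    have hsum : ∑' k, m (S.symm^[k] ⁻¹' E) ≠ ∞ := by
      simp_rw [← setLIntegral_cocycle hDm hD _ hE]
      rw [← lintegral_tsum fun k => (measurable_cocycle hDm k).coe_nnreal_ennreal.aemeasurable]
      refine ne_top_of_le_ne_top (b := N * m E) (by finiteness) ?_
      calc ∫⁻ z in E, F z ∂m ≤ ∫⁻ z in E, N ∂m := setLIntegral_mono measurable_const fun z hz => hz
        _ = N * m E := by simp
    have h1 := ae_finite_setOfPred_mem hsum
    have h2 := hcons.ae_mem_imp_frequently_image_mem hE.nullMeasurableSet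
    rw [measure_eq_zero_iff_ae_notMem]
    filter_upwards [h1, h2] with z hz1 hz2 hzE
    exact (Nat.frequently_atTop_iff_infinite.1 (hz2 hzE)) hz1
  have : ∀ᵐ z ∂m, ∀ N : ℕ, ¬ F z ≤ N := ae_all_iff.2 fun N =>
    measure_eq_zero_iff_ae_notMem.1 (key N)
  filter_upwards [this] with z hz
  by_contra hne
  obtain ⟨N, hN⟩ := ENNReal.exists_nat_gt hne
  exact hz N hN.le

end HopfArgument

/-! ### Comparison of orbits -/

namespace HopfArgument

open Classical in
/-- Two weight sequences `u`, `v` that are comparable up to the factor `c`, and two itineraries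
`P`, `P'` that eventually agree: if at most a proportion `l` of the weight `u` lies off `P`, and at
most a proportion `l` of the weight `v` lies on `P'`, then the total weight is finite as soon as
`l` is small compared with `c`. -/
lemma sum_bounded_of_comparable {u v : ℕ → ℝ} {P P' : ℕ → Prop} {c l : ℝ}
    (hu : ∀ k, 0 ≤ u k) (hv : ∀ k, 0 ≤ v k) (hc : 0 ≤ c) (hl : 0 ≤ l)
    (hcl : l + c * l * c ≤ 1 / 2)
    (huv : ∀ᶠ k in atTop, u k ≤ c * v k) (hvu : ∀ᶠ k in atTop, v k ≤ c * u k)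
    (hP : ∀ᶠ k in atTop, (P' k ↔ P k))
    (h1 : ∀ n, ∑ k ∈ Finset.range n, (if P k then 0 else u k) ≤ l * ∑ k ∈ Finset.range n, u k)
    (h2 : ∀ n, ∑ k ∈ Finset.range n, (if P' k then v k else 0) ≤ l * ∑ k ∈ Finset.range n, v k) :
    ∃ M, ∀ n, ∑ k ∈ Finset.range n, u k ≤ M := by
  obtain ⟨k₁, hk₁⟩ := eventually_atTop.1 (huv.and (hvu.and hP))
  have head : ∀ w : ℕ → ℝ, (∀ k, 0 ≤ w k) → ∀ n,
      ∑ k ∈ Finset.range n, (if k < k₁ then w k else 0) ≤ ∑ k ∈ Finset.range k₁, w k := by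
    intro w hw n
    rw [← Finset.sum_filter]
    refine Finset.sum_le_sum_of_subset_of_nonneg (fun k hk => ?_) fun k _ _ => hw k
    simp only [Finset.mem_filter] at hk
    exact Finset.mem_range.2 hk.2
  refine ⟨2 * (∑ k ∈ Finset.range k₁, u k + c * l * ∑ k ∈ Finset.range k₁, v k), fun n => ?_⟩
  have hs : ∑ k ∈ Finset.range n, u k ≤ ∑ k ∈ Finset.range n, (if k < k₁ then u k else 0) +
      ∑ k ∈ Finset.range n, (if P k then 0 else u k) +
      c * ∑ k ∈ Finset.range n, (if P' k then v k else 0) := by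
    rw [Finset.mul_sum, ← Finset.sum_add_distrib, ← Finset.sum_add_distrib]
    refine Finset.sum_le_sum fun k _ => ?_
    have hcv := mul_nonneg hc (hv k)
    by_cases hk : k < k₁
    · have := hu k
      split_ifs <;> simp <;> linarith
    · obtain ⟨ha, -, hb⟩ := hk₁ k (not_lt.1 hk)
      by_cases hPk : P k <;> simp [hk, hb, hPk, ha]
  have ht : ∑ k ∈ Finset.range n, v k ≤ ∑ k ∈ Finset.range n, (if k < k₁ then v k else 0) +
      c * ∑ k ∈ Finset.range n, u k := by
    rw [Finset.mul_sum, ← Finset.sum_add_distrib]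
    refine Finset.sum_le_sum fun k _ => ?_
    have hcu := mul_nonneg hc (hu k)
    by_cases hk : k < k₁
    · simp [hk, hcu]
    · simp [hk, (hk₁ k (not_lt.1 hk)).2.1]
  have hu0 := head u hu n
  have hv0 := head v hv n
  have hcl' : 0 ≤ c * l := mul_nonneg hc hl
  have e1 := mul_le_mul_of_nonneg_left (h2 n) hc
  have e2 := mul_le_mul_of_nonneg_left (ht.trans (add_le_add_left hv0 _)) hcl'
  have e3 := mul_le_mul_of_nonneg_right hcl
    (Finset.sum_nonneg fun k (_ : k ∈ Finset.range n) => hu k)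
  have e4 := h1 n
  linarith

variable {Z : Type*}

lemma orbitSum_indicator_toReal (S : Z → Z) (D : Z → ℝ≥0) (Q : Set Z) (n : ℕ) (z : Z)
    [DecidablePred (· ∈ Q)] :
    (orbitSum S D (Q.indicator 1) n z).toReal =
      ∑ k ∈ Finset.range n, if S^[k] z ∈ Q then (cocycle S D k z : ℝ) else 0 := by
  rw [orbitSum, ENNReal.toReal_sum]
  · refine Finset.sum_congr rfl fun k _ => ?_
    by_cases h : S^[k] z ∈ Q <;> simp [h]
  · intro k _
    by_cases h : S^[k] z ∈ Q <;> simp [h]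

lemma orbitSum_one (S : Z → Z) (D : Z → ℝ≥0) (n : ℕ) (z : Z) :
    orbitSum S D 1 n z = ((∑ k ∈ Finset.range n, cocycle S D k z : ℝ≥0) : ℝ≥0∞) := by
  simp [orbitSum]

lemma sum_le_of_not_lt {S : Z → Z} {D : Z → ℝ≥0} {Q : Set Z} {l : ℝ≥0} {z : Z}
    [DecidablePred (· ∈ Q)]
    (h : ¬ ∃ n, l * orbitSum S D 1 n z < orbitSum S D (Q.indicator 1) n z) (n : ℕ) :
    ∑ k ∈ Finset.range n, (if S^[k] z ∈ Q then (cocycle S D k z : ℝ) else 0) ≤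
      l * ∑ k ∈ Finset.range n, (cocycle S D k z : ℝ) := by
  push Not at h
  have h1 := ENNReal.toReal_mono (by rw [orbitSum_one]; finiteness) (h n)
  rw [orbitSum_indicator_toReal, orbitSum_one, ← ENNReal.coe_mul, ENNReal.coe_toReal] at h1
  exact_mod_cast h1

lemma mem_iterate_iff {S : Z → Z} {B : Set Z} (hB : S ⁻¹' B = B) (k : ℕ) (z : Z) :
    S^[k] z ∈ B ↔ z ∈ B := by
  induction k with
  | zero => rfl
  | succ k ih =>
    rw [Function.iterate_succ_apply', ← ih]
    exact Set.ext_iff.1 hB _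

variable [MeasurableSpace Z] {m : Measure Z} {S : Z ≃ᵐ Z} {D : Z → ℝ≥0}

/-- If an involution `σ` and the measures `m` and `m ∘ S^k` are compatible up to the factor `c`,
then the density of `m ∘ S^k` changes along `σ` by at most the factor `c²`. -/
lemma cocycle_comp_le [IsFiniteMeasure m] (hDm : Measurable D)
    (hD : m.map S.symm = m.withDensity fun z => D z) {σ : Z → Z} (hσm : Measurable σ)
    (hσσ : Function.Involutive σ) {c : ℝ≥0} (hσ : ∀ E, MeasurableSet E → m (σ ⁻¹' E) ≤ c * m E)
    {k : ℕ} (hk : ∀ E, MeasurableSet E →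
      m (S.symm^[k] ⁻¹' (σ ⁻¹' E)) ≤ c * m (S.symm^[k] ⁻¹' E)) :
    ∀ᵐ z ∂m, cocycle S D k (σ z) ≤ c * c * cocycle S D k z := by
  have hK : Measurable fun z => (cocycle S D k z : ℝ≥0∞) :=
    (measurable_cocycle hDm k).coe_nnreal_ennreal
  have hKσ : Measurable fun z => (cocycle S D k (σ z) : ℝ≥0∞) := hK.comp hσm
  have hle : m ≤ c • m.map σ := by
    refine Measure.le_iff.2 fun E hE => ?_
    rw [Measure.smul_apply, Measure.map_apply hσm hE]
    have := hσ _ (hσm hE)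
    rwa [← preimage_comp, hσσ.comp_self, preimage_id] at this
  have h : (fun z => (cocycle S D k (σ z) : ℝ≥0∞)) ≤ᵐ[m]
      fun z => c * c * (cocycle S D k z : ℝ≥0∞) := by
    refine ae_le_of_forall_setLIntegral_le_of_sigmaFinite hKσ fun E hE _ => ?_
    calc ∫⁻ z in E, cocycle S D k (σ z) ∂m
        ≤ ∫⁻ z in E, cocycle S D k (σ z) ∂(c • m.map σ) :=
          lintegral_mono' (Measure.restrict_mono le_rfl hle) le_rfl
      _ = c * ∫⁻ z in σ ⁻¹' E, cocycle S D k z ∂m := by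
          rw [Measure.restrict_smul, lintegral_smul_measure, Measure.restrict_map hσm hE,
            lintegral_map hKσ hσm]
          simp only [hσσ _]
          rfl
      _ ≤ c * (c * ∫⁻ z in E, cocycle S D k z ∂m) := by
          rw [setLIntegral_cocycle hDm hD k (hσm hE), setLIntegral_cocycle hDm hD k hE]
          gcongr
          exact hk E hE
      _ = ∫⁻ z in E, c * c * cocycle S D k z ∂m := by
          rw [lintegral_const_mul _ hK, mul_assoc]
  filter_upwards [h] with z hz
  exact_mod_cast hz

/-- The sets that the orbits of `z` and `σ z` eventually visit at the same times, uniformly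
in `z`. They form an algebra of sets. -/
def asymptoticSets (S σ : Z → Z) : Set (Set Z) :=
  {C | MeasurableSet C ∧ ∀ᶠ k in atTop, ∀ z, S^[k] (σ z) ∈ C ↔ S^[k] z ∈ C}

lemma isSetAlgebra_asymptoticSets (S σ : Z → Z) : IsSetAlgebra (asymptoticSets S σ) where
  empty_mem := ⟨.empty, by simp⟩
  compl_mem := fun s hs => ⟨hs.1.compl, by
    filter_upwards [hs.2] with k hk z
    simp [hk]⟩
  union_mem := fun s t hs ht => ⟨hs.1.union ht.1, by
    filter_upwards [hs.2, ht.2] with k hk hk' z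
    simp [hk, hk']⟩

/-- **Hopf's argument.** Suppose that the involution `σ` distorts `m` and (for large `k`)
`m ∘ S^k` by a bounded factor, and that `S^k z` and `S^k (σ z)` become indistinguishable by the sets
of a generating algebra. Then every `S`-invariant set is `σ`-invariant mod `m`: otherwise, with `C`
in the algebra close to the invariant set `B`, the maximal inequality yields a point `z ∈ B`
with `σ z ∉ B` such that most of the weight of the orbit of `z` lies on visits to `C`, and most
of the weight of the orbit of `σ z` on visits to `Cᶜ`. As the two orbits have comparable weights
and the same itineraries, the weights are summable, against the divergence of the cocycle. -/
theorem preimage_ae_eq_of_invariant [IsProbabilityMeasure m] (hDm : Measurable D)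
    (hD : m.map S.symm = m.withDensity fun z => D z)
    (hdiv : ∀ᵐ z ∂m, ∑' k, (cocycle S D k z : ℝ≥0∞) = ∞)
    {σ : Z → Z} (hσm : Measurable σ) (hσσ : Function.Involutive σ) {c : ℝ≥0}
    (hσ : ∀ E, MeasurableSet E → m (σ ⁻¹' E) ≤ c * m E)
    (hk : ∀ᶠ k in atTop, ∀ E, MeasurableSet E →
      m (S.symm^[k] ⁻¹' (σ ⁻¹' E)) ≤ c * m (S.symm^[k] ⁻¹' E))
    (hgen : ‹MeasurableSpace Z› = MeasurableSpace.generateFrom (asymptoticSets S σ))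
    {B : Set Z} (hB : MeasurableSet B) (hinv : S ⁻¹' B = B) : σ ⁻¹' B =ᵐ[m] B := by
  classical
  have hσq : Measure.QuasiMeasurePreserving σ m m :=
    ⟨hσm, .mk fun E hE h0 => by
      rw [Measure.map_apply hσm hE]
      simpa [h0] using hσ E hE⟩
  suffices hmain : m (B \ σ ⁻¹' B) = 0 by
    refine (ae_le_set.2 ?_).antisymm (ae_le_set.2 hmain)
    have := hσq.preimage_null hmain
    rwa [preimage_sdiff, ← preimage_comp, hσσ.comp_self, preimage_id] at this
  by_contra hG
  set G := B \ σ ⁻¹' B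
  -- The proportion `l` makes the two estimates of `sum_bounded_of_comparable` incompatible.
  set a : ℝ≥0 := c * c with ha
  set l : ℝ≥0 := (2 * (1 + a * a))⁻¹ with hl
  have hl0 : 0 < l := by positivity
  have hal : (l : ℝ) + a * l * a ≤ 1 / 2 := by
    have h1 : (l : ℝ) = (2 * (1 + (a : ℝ) * a))⁻¹ := by rw [hl]; push_cast; rfl
    have h2 : (0 : ℝ) < 1 + (a : ℝ) * a := by positivity
    rw [h1]
    apply le_of_eq
    field_simp
  set ε : ℝ≥0 := l * (m G).toNNReal / (2 * (1 + c)) with hε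
  have hG0 : 0 < (m G).toNNReal := ENNReal.toNNReal_pos hG (by finiteness)
  have hε0 : 0 < ε := by positivity
  obtain ⟨C, hC, hBC⟩ := (Measure.MeasureDense.of_generateFrom_isSetAlgebra_finite (μ := m)
    (isSetAlgebra_asymptoticSets S σ) hgen).approx B hB (by finiteness) ε (by exact_mod_cast hε0)
  have hBC' : m (B ∆ C) ≤ ε := by
    refine hBC.le.trans_eq ?_
    simp
  set Q := B ∆ C with hQ
  have hQm : MeasurableSet Q := hB.symmDiff hC.1
  set E := {z | ∃ n, l * orbitSum S D 1 n z < orbitSum S D (Q.indicator 1) n z} with hE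
  have hEle : m E ≤ ε / l := by
    rw [ENNReal.le_div_iff_mul_le (by simp [hl0.ne']) (by simp), mul_comm]
    exact (maximal_inequality hDm hD hQm l).trans hBC'
  obtain ⟨E', hEE', hE'm, hE'⟩ := exists_measurable_superset m E
  have hbad : m (E' ∪ σ ⁻¹' E') < m G := by
    calc m (E' ∪ σ ⁻¹' E') ≤ m E' + c * m E' :=
          (measure_union_le _ _).trans (by gcongr; exact hσ _ hE'm)
      _ ≤ ((1 + c) * (ε / l) : ℝ≥0) := by
          rw [hE']
          push_cast [ENNReal.coe_div hl0.ne']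
          rw [add_mul, one_mul]
          gcongr
      _ = ((m G).toNNReal / 2 : ℝ≥0) := by
          rw [hε]; congr 1; field_simp
      _ < (m G).toNNReal := by exact_mod_cast NNReal.half_lt_self hG0.ne'
      _ = m G := ENNReal.coe_toNNReal (by finiteness)
  have hcomp : ∀ᵐ z ∂m, ∀ᶠ k in atTop, cocycle S D k (σ z) ≤ a * cocycle S D k z := by
    obtain ⟨k₀, hk₀⟩ := eventually_atTop.1 hk
    have : ∀ᵐ z ∂m, ∀ k, k₀ ≤ k → cocycle S D k (σ z) ≤ a * cocycle S D k z :=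
      ae_all_iff.2 fun k => ae_all_iff.2 fun hk =>
        cocycle_comp_le hDm hD hσm hσσ hσ (hk₀ k hk)
    filter_upwards [this] with z hz
    exact eventually_atTop.2 ⟨k₀, hz⟩
  have hgood : ∃ z ∈ G \ (E' ∪ σ ⁻¹' E'), (∑' k, (cocycle S D k z : ℝ≥0∞) = ∞) ∧
      (∀ᶠ k in atTop, cocycle S D k (σ z) ≤ a * cocycle S D k z) ∧
      ∀ᶠ k in atTop, cocycle S D k z ≤ a * cocycle S D k (σ z) := by
    have hpos : m (G \ (E' ∪ σ ⁻¹' E')) ≠ 0 := fun h0 =>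
      hbad.not_ge (measure_mono_ae (ae_le_set.2 h0))
    have hcomp' := hσq.ae hcomp
    simp only [hσσ _] at hcomp'
    obtain ⟨z, hz, h⟩ := (frequently_ae_mem_iff.2 hpos).and_eventually
      (hdiv.and (hcomp.and hcomp')) |>.exists
    exact ⟨z, hz, h⟩
  obtain ⟨z, ⟨⟨hzB, hσzB⟩, hzE⟩, hzdiv, hz1, hz2⟩ := hgood
  have hzE1 : z ∉ E := fun h => hzE (Or.inl (hEE' h))
  have hzE2 : σ z ∉ E := fun h => hzE (Or.inr (hEE' h))
  obtain ⟨M, hM⟩ := sum_bounded_of_comparable (u := fun k => (cocycle S D k z : ℝ))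
    (v := fun k => (cocycle S D k (σ z) : ℝ)) (P := fun k => S^[k] z ∈ C)
    (P' := fun k => S^[k] (σ z) ∈ C) (c := a) (l := l) (fun _ => NNReal.coe_nonneg _)
    (fun _ => NNReal.coe_nonneg _) a.coe_nonneg l.coe_nonneg hal
    (hz2.mono fun k h => by exact_mod_cast h) (hz1.mono fun k h => by exact_mod_cast h)
    (hC.2.mono fun k h => h z)
    (fun n => by
      refine le_trans (le_of_eq (Finset.sum_congr rfl fun k _ => ?_)) (sum_le_of_not_lt hzE1 n)
      have : S^[k] z ∈ B := (mem_iterate_iff hinv k z).2 hzB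
      by_cases h : S^[k] z ∈ C <;> simp [hQ, mem_symmDiff, h, this])
    (fun n => by
      refine le_trans (le_of_eq (Finset.sum_congr rfl fun k _ => ?_)) (sum_le_of_not_lt hzE2 n)
      have : S^[k] (σ z) ∉ B := fun h => hσzB ((mem_iterate_iff hinv k _).1 h)
      by_cases h : S^[k] (σ z) ∈ C <;> simp [hQ, mem_symmDiff, h, this])
  have htop : ∑' k, (cocycle S D k z : ℝ≥0∞) ≤ ENNReal.ofReal M := by
    rw [ENNReal.tsum_eq_iSup_nat]
    refine iSup_le fun n => ?_
    rw [← ENNReal.ofNNReal_finsetSum, ← ENNReal.ofReal_coe_nnreal]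
    refine ENNReal.ofReal_le_ofReal ?_
    simpa using hM n
  rw [hzdiv] at htop
  exact ENNReal.ofReal_ne_top (top_le_iff.1 htop)

end HopfArgument

/-! ### Changing one coordinate of a product measure -/

namespace BernoulliShift

variable {A : Type*}

open Classical in
/-- Exchange the symbols `a` and `b` at the coordinate `n`. -/
noncomputable def swapAt (n : ℤ) (a b : A) (x : ℤ → A) : ℤ → A :=
  Function.update x n (Equiv.swap a b (x n))

lemma swapAt_of_ne {n j : ℤ} (h : j ≠ n) (a b : A) (x : ℤ → A) : swapAt n a b x j = x j := by
  simp [swapAt, h]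

lemma swapAt_involutive (n : ℤ) (a b : A) : Function.Involutive (swapAt n a b) := by
  intro x
  simp [swapAt]

lemma swapAt_apply_self (n : ℤ) (a : A) (x : ℤ → A) :
    swapAt n a (x n) x = Function.update x n a := by
  simp [swapAt]

lemma update_mem_pi {s : Finset ℤ} {t : ℤ → Set A} {n : ℤ} {a : A} {x : ℤ → A} :
    Function.update x n a ∈ (s : Set ℤ).pi t ↔
      (n ∈ s → a ∈ t n) ∧ x ∈ ((s.erase n : Finset ℤ) : Set ℤ).pi t := by
  simp only [Set.mem_pi, Finset.mem_coe, Finset.mem_erase]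
  constructor
  · intro h
    exact ⟨fun hn => by simpa using h n hn, fun i hi => by simpa [hi.1] using h i hi.2⟩
  · rintro ⟨h1, h2⟩ i hi
    by_cases hin : i = n
    · subst hin; simpa using h1 hi
    · simpa [hin] using h2 i ⟨hin, hi⟩

variable [MeasurableSpace A]

lemma leftShift_iterate_apply (k : ℕ) (x : ℤ → A) (n : ℤ) :
    (leftShift A)^[k] x n = x (n - k) := by
  induction k generalizing n with
  | zero => simp
  | succ k ih =>
    rw [Function.iterate_succ_apply']
    change (leftShift A)^[k] x (n - 1) = _
    rw [ih]
    congr 1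
    push_cast
    ring

lemma leftShift_symm_iterate_apply (k : ℕ) (x : ℤ → A) (n : ℤ) :
    (leftShift A).symm^[k] x n = x (n + k) := by
  induction k generalizing n with
  | zero => simp
  | succ k ih =>
    rw [Function.iterate_succ_apply']
    change (leftShift A).symm^[k] x (n + 1) = _
    rw [ih]
    congr 1
    push_cast
    ring

lemma swapAt_leftShift_symm_iterate (k : ℕ) (n : ℤ) (a b : A) (x : ℤ → A) :
    swapAt n a b ((leftShift A).symm^[k] x) = (leftShift A).symm^[k] (swapAt (n + k) a b x) := by
  ext j
  by_cases hj : j = n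
  · subst hj
    simp [swapAt, leftShift_symm_iterate_apply]
  · have : j + (k : ℤ) ≠ n + k := by simpa using hj
    rw [leftShift_symm_iterate_apply, swapAt_of_ne hj, swapAt_of_ne this,
      leftShift_symm_iterate_apply]

variable [DiscreteMeasurableSpace A]

@[fun_prop]
lemma measurable_swapAt (n : ℤ) (a b : A) : Measurable (swapAt n a b) := by
  refine measurable_pi_lambda _ fun j => ?_
  by_cases hj : j = n
  · subst hj
    have h : (fun x : ℤ → A => swapAt j a b x j) = (fun d => by
        classical exact Equiv.swap a b d) ∘ fun x => x j := by
      ext x; simp [swapAt]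
    rw [h]
    exact Measurable.of_discrete.comp (measurable_pi_apply j)
  · simp only [swapAt_of_ne hj]
    exact measurable_pi_apply j

variable [Fintype A] {μ : ℤ → Measure A} [∀ n, IsProbabilityMeasure (μ n)]

omit [∀ n, IsProbabilityMeasure (μ n)] in
lemma sum_singleton_mul_indicator (n : ℤ) (U : Set A) :
    ∑ a, μ n {a} * U.indicator 1 a = μ n U := by
  rw [← lintegral_indicator_one (MeasurableSet.of_discrete (s := U)), lintegral_fintype]
  exact Finset.sum_congr rfl fun a _ => mul_comm _ _

/-- The coordinate `n` is independent of the others: resampling it does not change the product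
measure. -/
lemma infinitePi_apply_eq_sum (n : ℤ) {E : Set (ℤ → A)} (hE : MeasurableSet E) :
    Measure.infinitePi μ E =
      ∑ a, μ n {a} * Measure.infinitePi μ ((fun x => Function.update x n a) ⁻¹' E) := by
  have hu : ∀ a : A, Measurable fun x : ℤ → A => Function.update x n a := fun a =>
    measurable_update_left
  have h : ∑ a, μ n {a} • (Measure.infinitePi μ).map (fun x => Function.update x n a) =
      Measure.infinitePi μ := by
    refine Measure.eq_infinitePi μ fun s t ht => ?_
    have hbox : MeasurableSet ((s : Set ℤ).pi t) :=
      .pi s.countable_toSet fun i _ => ht i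
    have hterm : ∀ a, μ n {a} * Measure.infinitePi μ
        ((fun x => Function.update x n a) ⁻¹' (s : Set ℤ).pi t) =
        (μ n {a} * {a | n ∈ s → a ∈ t n}.indicator 1 a) * ∏ i ∈ s.erase n, μ i (t i) := by
      intro a
      by_cases ha : n ∈ s → a ∈ t n
      · have : (fun x => Function.update x n a) ⁻¹' (s : Set ℤ).pi t =
            ((s.erase n : Finset ℤ) : Set ℤ).pi t := by
          ext x; rw [mem_preimage, update_mem_pi, and_iff_right ha]
        rw [this, Measure.infinitePi_pi μ fun i _ => ht i,
          indicator_of_mem (show a ∈ {a | n ∈ s → a ∈ t n} from ha)]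
        simp
      · have : (fun x => Function.update x n a) ⁻¹' (s : Set ℤ).pi t = ∅ := by
          ext x; simp only [mem_preimage, update_mem_pi, ha, false_and, mem_empty_iff_false]
        rw [this, indicator_of_notMem (show a ∉ {a | n ∈ s → a ∈ t n} from ha)]
        simp
    simp only [Measure.coe_finsetSum, Finset.sum_apply, Measure.smul_apply, smul_eq_mul]
    simp_rw [Measure.map_apply (hu _) hbox, hterm]
    rw [← Finset.sum_mul, sum_singleton_mul_indicator]
    by_cases hn : n ∈ s
    · simp [hn, Finset.mul_prod_erase s (fun i => μ i (t i)) hn]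
    · simp [hn]
  conv_lhs => rw [← h]
  simp only [Measure.coe_finsetSum, Finset.sum_apply, Measure.smul_apply, smul_eq_mul]
  simp_rw [Measure.map_apply (hu _) hE]

lemma infinitePi_preimage_swapAt_le {n : ℤ} {c : ℝ≥0}
    (hc : ∀ a b, μ n {a} ≤ c * μ n {b}) (a b : A) {E : Set (ℤ → A)} (hE : MeasurableSet E) :
    Measure.infinitePi μ (swapAt n a b ⁻¹' E) ≤ c * Measure.infinitePi μ E := by
  classical
  have h : ∀ d, (fun x => Function.update x n (Equiv.swap a b d)) ⁻¹' (swapAt n a b ⁻¹' E) =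
      (fun x => Function.update x n d) ⁻¹' E := by
    intro d
    ext x
    have : swapAt n a b (Function.update x n (Equiv.swap a b d)) = Function.update x n d := by
      simp only [swapAt, Function.update_self, Function.update_idem]
      congr 1
      convert Equiv.swap_apply_self a b d
    simp [this]
  calc Measure.infinitePi μ (swapAt n a b ⁻¹' E)
      = ∑ d, μ n {Equiv.swap a b d} *
          Measure.infinitePi μ ((fun x => Function.update x n d) ⁻¹' E) := by
        rw [infinitePi_apply_eq_sum n (measurable_swapAt n a b hE),
          ← Equiv.sum_comp (Equiv.swap a b)]
        simp_rw [h]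
    _ ≤ ∑ d, c * (μ n {d} * Measure.infinitePi μ ((fun x => Function.update x n d) ⁻¹' E)) := by
        refine Finset.sum_le_sum fun d _ => ?_
        rw [← mul_assoc]
        gcongr
        exact hc _ _
    _ = c * Measure.infinitePi μ E := by
        rw [← Finset.mul_sum, ← infinitePi_apply_eq_sum n hE]

/-- A zero-one law: a set which is invariant mod `0` under all changes of one coordinate is
independent of every cylinder, hence of itself. -/
theorem infinitePi_eq_zero_or_one {B : Set (ℤ → A)} (hB : MeasurableSet B)
    (hswap : ∀ n a b, swapAt n a b ⁻¹' B =ᵐ[Measure.infinitePi μ] B) :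
    Measure.infinitePi μ B = 0 ∨ Measure.infinitePi μ B = 1 := by
  set P := Measure.infinitePi μ with hP
  have hupd : ∀ n a, ∀ᵐ x ∂P, (Function.update x n a ∈ B ↔ x ∈ B) := by
    intro n a
    have : ∀ᵐ x ∂P, ∀ b, (swapAt n a b x ∈ B ↔ x ∈ B) :=
      ae_all_iff.2 fun b => (hswap n a b).mem_iff
    filter_upwards [this] with x hx
    rw [← swapAt_apply_self]
    exact hx _
  have hbox : ∀ (t : ℤ → Set A) (s : Finset ℤ), MeasurableSet ((s : Set ℤ).pi t) := fun t s =>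
    .pi s.countable_toSet fun _ _ => .of_discrete
  have hind : ∀ (t : ℤ → Set A) (s : Finset ℤ),
      P (B ∩ (s : Set ℤ).pi t) = P B * ∏ i ∈ s, μ i (t i) := by
    intro t s
    induction s using Finset.induction_on with
    | empty => simp
    | insert i s hi ih =>
      have hterm : ∀ a, P ((fun x => Function.update x i a) ⁻¹'
          (B ∩ ((insert i s : Finset ℤ) : Set ℤ).pi t)) =
          (t i).indicator 1 a * P (B ∩ (s : Set ℤ).pi t) := by
        intro a
        by_cases ha : a ∈ t i
        · rw [indicator_of_mem ha, Pi.one_apply, one_mul]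
          refine measure_congr ?_
          filter_upwards [hupd i a] with x hx
          refine propext ?_
          change (Function.update x i a ∈ B ∧ Function.update x i a ∈ _) ↔ (x ∈ B ∧ x ∈ _)
          rw [hx, update_mem_pi, Finset.erase_insert hi]
          simp [ha]
        · have : (fun x => Function.update x i a) ⁻¹'
              (B ∩ ((insert i s : Finset ℤ) : Set ℤ).pi t) = ∅ := by
            ext x
            rw [mem_preimage, mem_inter_iff, update_mem_pi]
            simp [ha]
          rw [this, indicator_of_notMem ha]
          simp
      rw [hP, infinitePi_apply_eq_sum i (hB.inter (hbox _ _)), ← hP]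
      simp_rw [hterm, ← mul_assoc]
      rw [← Finset.sum_mul, sum_singleton_mul_indicator, ih, Finset.prod_insert hi]
      ring
  by_cases h0 : P B = 0
  · exact Or.inl h0
  · right
    have h : (P B)⁻¹ • P.restrict B = P := by
      refine Measure.eq_infinitePi μ fun s t _ => ?_
      rw [Measure.smul_apply, Measure.restrict_apply (hbox t s), inter_comm, hind, smul_eq_mul,
        ← mul_assoc, ENNReal.inv_mul_cancel h0 (by finiteness), one_mul]
    rw [← prob_compl_eq_zero_iff hB, ← h, Measure.smul_apply, Measure.restrict_apply hB.compl]
    simp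

end BernoulliShift

/-! ### Products of a Bernoulli shift with a probability preserving transformation -/

namespace BernoulliShift

open HopfArgument

lemma cocycle_comp_fst {X Y : Type*} (T : X → X) (R : Y → Y) (D : X → ℝ≥0) (k : ℕ) (z : X × Y) :
    cocycle (Prod.map T R) (fun w => D w.1) k z = cocycle T D k z.1 := by
  simp [cocycle, Prod.map_iterate]

lemma exists_nnreal_density {X : Type*} [MeasurableSpace X] {P Q : Measure X} [SigmaFinite P]
    [SigmaFinite Q] (h : Q ≪ P) :
    ∃ D : X → ℝ≥0, Measurable D ∧ Q = P.withDensity fun x => D x := by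
  refine ⟨fun x => (Q.rnDeriv P x).toNNReal, (Measure.measurable_rnDeriv Q P).ennreal_toNNReal, ?_⟩
  rw [← Measure.withDensity_rnDeriv_eq Q P h]
  refine withDensity_congr_ae ?_
  rw [Measure.withDensity_rnDeriv_eq Q P h]
  filter_upwards [Measure.rnDeriv_lt_top Q P] with x hx
  exact (ENNReal.coe_toNNReal hx.ne).symm

variable {A Y : Type*} [MeasurableSpace A] [MeasurableSpace Y]

lemma measure_preimage_prodMap_id_le {X : Type*} [MeasurableSpace X] {P : Measure X} [SFinite P]
    {ν : Measure Y} [SFinite ν] {g : X → X} (hg : Measurable g) {c : ℝ≥0}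
    (h : ∀ E, MeasurableSet E → P (g ⁻¹' E) ≤ c * P E) {E : Set (X × Y)} (hE : MeasurableSet E) :
    P.prod ν (Prod.map g id ⁻¹' E) ≤ c * P.prod ν E := by
  rw [Measure.prod_apply_symm (hg.prodMap measurable_id hE), Measure.prod_apply_symm hE,
    ← lintegral_const_mul _ (measurable_measure_prodMk_right hE)]
  exact lintegral_mono fun y => h _ (measurable_prodMk_right hE)

/-- Two points that differ in one coordinate only have orbits which, under the left shift, agree
in the long run on every finite window. -/
lemma generateFrom_asymptoticSets [DiscreteMeasurableSpace A] (R : Y ≃ᵐ Y) (n : ℤ) (a b : A) :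
    (inferInstance : MeasurableSpace ((ℤ → A) × Y)) = MeasurableSpace.generateFrom
      (asymptoticSets ((leftShift A).prodCongr R) (Prod.map (swapAt n a b) id)) := by
  have hiter : ∀ (k : ℕ) (z : (ℤ → A) × Y), ((leftShift A).prodCongr R)^[k] z =
      ((leftShift A)^[k] z.1, R^[k] z.2) := fun k z => by
    change (Prod.map (leftShift A) R)^[k] z = _
    rw [Prod.map_iterate]; rfl
  refine le_antisymm (sup_le ?_ ?_) (MeasurableSpace.generateFrom_le fun _ h => h.1)
  · rw [← measurable_iff_comap_le]
    refine @measurable_pi_lambda _ _ _ (_) _ _ fun j U hU =>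
      MeasurableSpace.measurableSet_generateFrom ⟨?_, ?_⟩
    · exact ((measurable_pi_apply j).comp measurable_fst) hU
    · filter_upwards [eventually_gt_atTop (j - n).toNat] with k hk z
      have hne : j - (k : ℤ) ≠ n := by omega
      simp [hiter, leftShift_iterate_apply, swapAt_of_ne hne]
  · rw [← measurable_iff_comap_le]
    refine fun V hV => MeasurableSpace.measurableSet_generateFrom ⟨measurable_snd hV, ?_⟩
    simp [hiter]

variable [DiscreteMeasurableSpace A] [Fintype A] {μ : ℤ → Measure A}
  [∀ n, IsProbabilityMeasure (μ n)]

/-- An invariant set of the product is, mod `0`, invariant under the change of one coordinate. For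
large `k`, the coordinate `n` of `T^{-k} x` is the coordinate `n + k > 0` of `x`, where the
marginals are uniformly comparable with their images under permutations. -/
lemma preimage_swapAt_ae_eq (hns : IsNonsingular (leftShift A) (Measure.infinitePi μ))
    (hcons : Conservative (leftShift A) (Measure.infinitePi μ))
    (hpos : ∀ n a, μ n {a} ≠ 0) {c₀ : ℝ≥0} (hc₀ : ∀ n > 0, ∀ a b, μ n {a} ≤ c₀ * μ n {b})
    {ν : Measure Y} [IsProbabilityMeasure ν] {R : Y ≃ᵐ Y} (hR : MeasurePreserving R ν ν)
    {B : Set ((ℤ → A) × Y)} (hB : MeasurableSet B)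
    (hinv : (leftShift A).prodCongr R ⁻¹' B = B) (n : ℤ) (a b : A) :
    Prod.map (swapAt n a b) id ⁻¹' B =ᵐ[(Measure.infinitePi μ).prod ν] B := by
  set P := Measure.infinitePi μ with hP
  set T := leftShift A with hT
  have habs : P.map T.symm ≪ P := by
    have := hns.2.map T.symm.measurable
    rwa [Measure.map_map T.symm.measurable T.measurable, T.symm_comp_self, Measure.map_id] at this
  have : IsProbabilityMeasure (P.map T.symm) :=
    Measure.isProbabilityMeasure_map T.symm.measurable.aemeasurable
  obtain ⟨D, hDm, hD⟩ := exists_nnreal_density habs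
  have hDS : (P.prod ν).map (T.prodCongr R).symm = (P.prod ν).withDensity fun z => D z.1 := by
    change (P.prod ν).map (Prod.map T.symm R.symm) = _
    rw [← Measure.map_prod_map _ _ T.symm.measurable R.symm.measurable, hD,
      (hR.symm R).map_eq, prod_withDensity_left hDm.coe_nnreal_ennreal]
  have hdiv : ∀ᵐ z ∂P.prod ν,
      ∑' k, (cocycle (T.prodCongr R) (fun w => D w.1) k z : ℝ≥0∞) = ∞ := by
    filter_upwards [Measure.quasiMeasurePreserving_fst.ae (tsum_cocycle_eq_top hDm hD hcons)]
      with z hz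
    rw [← hz]
    congr with k
    exact congrArg _ (cocycle_comp_fst _ _ D k z)
  obtain ⟨c₁, hc₁⟩ : ∃ c₁ : ℝ≥0, ∀ a b, μ n {a} ≤ c₁ * μ n {b} := by
    refine ⟨∑ d, (μ n {d}).toNNReal⁻¹, fun a b => ?_⟩
    have hb : (μ n {b}).toNNReal ≠ 0 := by simp [ENNReal.toNNReal_eq_zero_iff, hpos]
    calc μ n {a} ≤ 1 := prob_le_one
      _ = ((μ n {b}).toNNReal⁻¹ : ℝ≥0) * μ n {b} := by
        rw [ENNReal.coe_inv hb, ENNReal.coe_toNNReal (by finiteness),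
          ENNReal.inv_mul_cancel (hpos n b) (by finiteness)]
      _ ≤ _ := by
        gcongr
        exact Finset.single_le_sum (f := fun d => (μ n {d}).toNNReal⁻¹) (fun _ _ => zero_le)
          (Finset.mem_univ b)
  have hle : ∀ {j : ℤ} {c : ℝ≥0}, c ≤ max c₀ c₁ → (∀ a b, μ j {a} ≤ c * μ j {b}) →
      ∀ E, MeasurableSet E →
        P.prod ν (Prod.map (swapAt j a b) id ⁻¹' E) ≤ (max c₀ c₁ : ℝ≥0) * P.prod ν E := by
    intro j c hc h E hE
    refine measure_preimage_prodMap_id_le (measurable_swapAt j a b) (fun F hF => ?_) hE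
    refine infinitePi_preimage_swapAt_le (fun a b => (h a b).trans ?_) a b hF
    gcongr
  refine preimage_ae_eq_of_invariant (c := max c₀ c₁) (hDm.comp measurable_fst) hDS hdiv
    ((measurable_swapAt n a b).prodMap measurable_id)
    (fun z => Prod.ext (swapAt_involutive n a b z.1) rfl) (hle (le_max_right _ _) hc₁) ?_
    (generateFrom_asymptoticSets R n a b) hB hinv
  filter_upwards [eventually_gt_atTop (-n).toNat] with k hk E hE
  have hcomm : (T.prodCongr R).symm^[k] ⁻¹' (Prod.map (swapAt n a b) id ⁻¹' E) =
      Prod.map (swapAt (n + k) a b) id ⁻¹' ((T.prodCongr R).symm^[k] ⁻¹' E) := by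
    have hiter : ∀ z : (ℤ → A) × Y, (T.prodCongr R).symm^[k] z =
        (T.symm^[k] z.1, R.symm^[k] z.2) := fun z => by
      change (Prod.map T.symm R.symm)^[k] z = _
      rw [Prod.map_iterate]; rfl
    ext z
    rw [mem_preimage, mem_preimage, mem_preimage, mem_preimage, hiter, hiter, Prod.map_fst,
      Prod.map_snd, ← swapAt_leftShift_symm_iterate]
    rfl
  rw [hcomm]
  exact hle (le_max_left _ _) (hc₀ (n + k) (by omega)) _
    ((T.prodCongr R).symm.measurable.iterate k hE)

theorem isWeaklyMixing_of_pos (hns : IsNonsingular (leftShift A) (Measure.infinitePi μ))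
    (hcons : Conservative (leftShift A) (Measure.infinitePi μ))
    (hpos : ∀ n a, μ n {a} ≠ 0) {c : ℝ≥0} (hc : ∀ n > 0, ∀ a b, μ n {a} ≤ c * μ n {b}) :
    IsWeaklyMixing (leftShift A) (Measure.infinitePi μ) := by
  refine ⟨hns, fun Y _ _ ν _ R hR => ?_⟩
  have hq : Measure.QuasiMeasurePreserving ((leftShift A).prodCongr R)
      ((Measure.infinitePi μ).prod ν) ((Measure.infinitePi μ).prod ν) :=
    QuasiMeasurePreserving.prodMap hcons.toQuasiMeasurePreserving
      hR.quasiErgodic.toQuasiMeasurePreserving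
  refine { toQuasiMeasurePreserving := hq, aeconst_set := fun B hB hinv => ?_ }
  set P := Measure.infinitePi μ with hP
  have hsec : ∀ y, MeasurableSet ((fun x => (x, y)) ⁻¹' B) := fun y => measurable_prodMk_right hB
  have hswap : ∀ᵐ y ∂ν, ∀ n a b, ∀ᵐ x ∂P, ((swapAt n a b x, y) ∈ B ↔ (x, y) ∈ B) := by
    refine ae_all_iff.2 fun n => ae_all_iff.2 fun a => ae_all_iff.2 fun b => ?_
    have h := (preimage_swapAt_ae_eq hns hcons hpos hc hR.toMeasurePreserving hB hinv n a b).mem_iff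
    exact Measure.ae_ae_of_ae_prod
      (Measure.measurePreserving_swap.quasiMeasurePreserving.ae h)
  have h01 : ∀ᵐ y ∂ν, P ((fun x => (x, y)) ⁻¹' B) = 0 ∨ P ((fun x => (x, y)) ⁻¹' B) = 1 := by
    filter_upwards [hswap] with y hy
    exact infinitePi_eq_zero_or_one (hsec y) fun n a b => (hy n a b).mono fun x hx => propext hx
  -- The points whose fibre is null form an invariant set of the ergodic transformation `R`.
  have hN : MeasurableSet {y | P ((fun x => (x, y)) ⁻¹' B) = 0} :=
    measurable_measure_prodMk_right hB (measurableSet_singleton 0)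
  have hNinv : R ⁻¹' {y | P ((fun x => (x, y)) ⁻¹' B) = 0} =
      {y | P ((fun x => (x, y)) ⁻¹' B) = 0} := by
    ext y
    have hfib : (fun x => (x, y)) ⁻¹' B = leftShift A ⁻¹' ((fun x => (x, R y)) ⁻¹' B) := by
      conv_lhs => rw [← hinv]
      rfl
    change P ((fun x => (x, R y)) ⁻¹' B) = 0 ↔ P ((fun x => (x, y)) ⁻¹' B) = 0
    rw [hfib, ← Measure.map_apply (leftShift A).measurable (hsec _)]
    exact ⟨fun h => hns.1 h, fun h => hns.2 h⟩
  rw [eventuallyConst_set']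
  rcases hR.toPreErgodic.ae_mem_or_ae_notMem hN hNinv with h | h
  · left
    refine ae_eq_empty.2 ?_
    rw [Measure.prod_apply_symm hB]
    exact (lintegral_congr_ae h).trans lintegral_zero
  · right
    rw [ae_eq_univ, Measure.prod_apply_symm hB.compl]
    refine (lintegral_congr_ae ?_).trans lintegral_zero
    filter_upwards [h, h01] with y hy hy01
    exact (prob_compl_eq_zero_iff (hsec y)).2 (hy01.resolve_left hy)

/-- Nonsingularity makes the marginals at `n ≤ 0` charge every symbol too, although without a
uniform lower bound. -/
theorem isWeaklyMixing_of_conservative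
    (hns : IsNonsingular (leftShift A) (Measure.infinitePi μ))
    (hδ : 0 < ⨅ (n : ℤ) (_ : 0 < n) (a : A), μ n {a})
    (hcons : Conservative (leftShift A) (Measure.infinitePi μ)) :
    IsWeaklyMixing (leftShift A) (Measure.infinitePi μ) := by
  set δ := ⨅ (n : ℤ) (_ : 0 < n) (a : A), μ n {a} with hδdef
  have hle : ∀ n > 0, ∀ a, δ ≤ μ n {a} := fun n hn a =>
    (iInf₂_le n hn).trans (iInf_le _ a)
  -- The marginal of `μ ∘ T⁻¹` at `n` is `μ (n - 1)`.
  have hstep : ∀ n a, μ n {a} ≠ 0 → μ (n - 1) {a} ≠ 0 := by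
    intro n a hna h0
    refine hna ?_
    rw [← Measure.infinitePi_map_eval μ n, Measure.map_apply (by fun_prop) (.singleton a)]
    refine hns.2 ?_
    rw [Measure.map_apply (leftShift A).measurable
      ((measurable_pi_apply n) (.singleton a))]
    rw [← Measure.infinitePi_map_eval μ (n - 1), Measure.map_apply (by fun_prop) (.singleton a)]
      at h0
    exact h0
  have hpos : ∀ n a, μ n {a} ≠ 0 := by
    intro n a
    have h1 : ∀ k : ℕ, μ (1 - k) {a} ≠ 0 := by
      intro k
      induction k with
      | zero => simpa using (hδ.trans_le (hle 1 one_pos a)).ne'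
      | succ k ih =>
        have := hstep _ a ih
        rwa [show (1 : ℤ) - (k : ℤ) - 1 = 1 - ((k + 1 : ℕ) : ℤ) by push_cast; ring] at this
    by_cases hn : 0 < n
    · exact (hδ.trans_le (hle n hn a)).ne'
    · have := h1 (1 - n).toNat
      rwa [show (1 : ℤ) - ((1 - n).toNat : ℤ) = n by omega] at this
  refine isWeaklyMixing_of_pos hns hcons hpos (c := (δ⁻¹).toNNReal) fun n hn a b => ?_
  rw [ENNReal.coe_toNNReal (by simpa using hδ.ne')]
  calc μ n {a} ≤ 1 := prob_le_one
    _ = δ⁻¹ * δ := (ENNReal.inv_mul_cancel hδ.ne'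
        (ne_top_of_le_ne_top (by finiteness) (hle n hn b))).symm
    _ ≤ δ⁻¹ * μ n {b} := by gcongr; exact hle n hn b

end BernoulliShift

/-! ### Cartesian powers -/

section Conjugacy

variable {X X' : Type*} [MeasurableSpace X] [MeasurableSpace X'] {P : Measure X} {P' : Measure X'}
  {T : X ≃ᵐ X} {T' : X' ≃ᵐ X'} {e : X ≃ᵐ X'}

lemma isNonsingular_congr (he : MeasurePreserving e P P') (h : ∀ x, e (T x) = T' (e x)) :
    IsNonsingular T P ↔ IsNonsingular T' P' := by
  have hmap : P'.map T' = (P.map T).map e := by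
    rw [← he.map_eq, Measure.map_map T'.measurable e.measurable,
      Measure.map_map e.measurable T.measurable]
    exact congrArg (fun f => P.map f) (funext fun x => (h x).symm)
  have hsymm : ∀ Q : Measure X, (Q.map e).map e.symm = Q := fun Q => e.symm.map_map_symm
  have hiff : ∀ Q Q' : Measure X, Q ≪ Q' ↔ Q.map e ≪ Q'.map e := fun Q Q' =>
    ⟨fun h => h.map e.measurable, fun h => by
      simpa only [hsymm] using h.map e.symm.measurable⟩
  rw [IsNonsingular, IsNonsingular, hmap, ← he.map_eq, ← hiff, ← hiff]

lemma conservative_of_conj (he : MeasurePreserving e P P') (h : ∀ x, e (T x) = T' (e x))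
    (hT : Conservative T P) (hns : IsNonsingular T' P') : Conservative T' P' where
  measurable := T'.measurable
  absolutelyContinuous := hns.1
  exists_mem_iterate_mem' := by
    intro s hs h0
    rw [← he.measure_preimage hs.nullMeasurableSet] at h0
    obtain ⟨x, hx, n, hn, hxn⟩ := hT.exists_mem_iterate_mem' (e.measurable hs) h0
    refine ⟨e x, hx, n, hn, ?_⟩
    have hsc : Function.Semiconj e T T' := h
    rw [← (hsc.iterate_right n).eq]
    exact hxn

lemma isWeaklyMixing_of_conj [SFinite P] [SFinite P'] (he : MeasurePreserving e P P')
    (h : ∀ x, e (T x) = T' (e x)) (hT' : IsWeaklyMixing T' P') : IsWeaklyMixing T P := by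
  have hns : IsNonsingular T P := (isNonsingular_congr he h).2 hT'.1
  refine ⟨hns, fun Y _ _ ν _ R hR => ?_⟩
  have hq : Measure.QuasiMeasurePreserving (T.prodCongr R) (P.prod ν) (P.prod ν) :=
    QuasiMeasurePreserving.prodMap ⟨T.measurable, hns.1⟩
      hR.quasiErgodic.toQuasiMeasurePreserving
  have hpre : PreErgodic (T.prodCongr R) (P.prod ν) := by
    have hE : MeasurePreserving (e.prodCongr (.refl Y)) (P.prod ν) (P'.prod ν) :=
      he.prod (.id ν)
    rw [← hE.preErgodic_conjugate_iff]
    convert (hT'.2 Y ν R hR).toPreErgodic using 1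
    ext z
    · change e (T (e.symm z.1)) = T' z.1
      rw [h, e.apply_symm_apply]
    · rfl
  exact { hq, hpre with }

end Conjugacy

lemma pi_absolutelyContinuous_pi {X : Type*} [MeasurableSpace X] {P Q : Measure X}
    [SigmaFinite P] [SigmaFinite Q] (h : P ≪ Q) (p : ℕ) :
    (Measure.pi fun _ : Fin p => P) ≪ Measure.pi fun _ : Fin p => Q := by
  induction p with
  | zero => rw [Measure.pi_of_empty, Measure.pi_of_empty]
  | succ p ih =>
    rw [← ((measurePreserving_piFinSuccAbove (fun _ : Fin (p + 1) => P) 0).symm _).map_eq,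
      ← ((measurePreserving_piFinSuccAbove (fun _ : Fin (p + 1) => Q) 0).symm _).map_eq]
    exact (h.prod ih).map (MeasurableEquiv.measurable _)

lemma isNonsingular_cartesianPower {X : Type*} [MeasurableSpace X] {T : X ≃ᵐ X} {P : Measure X}
    [IsProbabilityMeasure P] (h : IsNonsingular T P) (p : ℕ) :
    IsNonsingular (cartesianPower p T) (Measure.pi fun _ : Fin p => P) := by
  have : IsProbabilityMeasure (P.map T) := Measure.isProbabilityMeasure_map T.measurable.aemeasurable
  have hmap : (Measure.pi fun _ : Fin p => P).map (cartesianPower p T) =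
      Measure.pi fun _ : Fin p => P.map T :=
    Measure.pi_map_pi fun _ => T.measurable.aemeasurable
  rw [IsNonsingular, hmap]
  exact ⟨pi_absolutelyContinuous_pi h.1 p, pi_absolutelyContinuous_pi h.2 p⟩

/-- The identification of `(A^ℤ)^p` with `(A^p)^ℤ`. -/
def flipEquiv (A : Type*) [MeasurableSpace A] (p : ℕ) : (Fin p → ℤ → A) ≃ᵐ (ℤ → Fin p → A) where
  toFun x n i := x i n
  invFun y i n := y n i
  left_inv _ := rfl
  right_inv _ := rfl
  measurable_toFun := by
    show Measurable fun (x : Fin p → ℤ → A) (n : ℤ) (i : Fin p) => x i n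
    fun_prop
  measurable_invFun := by
    show Measurable fun (y : ℤ → Fin p → A) (i : Fin p) (n : ℤ) => y n i
    fun_prop

lemma measurePreserving_flipEquiv {A : Type*} [MeasurableSpace A] (μ : ℤ → Measure A)
    [∀ n, IsProbabilityMeasure (μ n)] (p : ℕ) :
    MeasurePreserving (flipEquiv A p) (Measure.pi fun _ : Fin p => Measure.infinitePi μ)
      (Measure.infinitePi fun n => Measure.pi fun _ : Fin p => μ n) := by
  refine ⟨(flipEquiv A p).measurable, ?_⟩
  simp_rw [← Measure.infinitePi_eq_pi]
  rw [← Measure.infinitePi_map_curry fun (_ : Fin p) n => μ n,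
    ← Measure.infinitePi_map_curry fun n (_ : Fin p) => μ n,
    ← Measure.infinitePi_map_piCongrLeft (X := fun _ => A) (fun q : ℤ × Fin p => μ q.1)
      (Equiv.prodComm (Fin p) ℤ),
    Measure.map_map (by fun_prop) (by fun_prop), Measure.map_map (by fun_prop) (by fun_prop)]
  congr 1

theorem corollary3p2 {A : Type*} [Finite A] [MeasurableSpace A] [DiscreteMeasurableSpace A]
    (μ : ℤ → Measure A) [∀ n, IsProbabilityMeasure (μ n)]
    (hns : IsNonsingular (leftShift A) (Measure.infinitePi μ))
    (hδ : 0 < ⨅ (n : ℤ) (_ : 0 < n) (a : A), μ n {a}) :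
    (Conservative (leftShift A) (Measure.infinitePi μ) →
      IsWeaklyMixing (leftShift A) (Measure.infinitePi μ)) ∧
    ∀ p : ℕ, 1 < p →
      Conservative (cartesianPower p (leftShift A))
        (Measure.pi fun _ : Fin p => Measure.infinitePi μ) →
      IsWeaklyMixing (cartesianPower p (leftShift A))
        (Measure.pi fun _ : Fin p => Measure.infinitePi μ) := by
  cases nonempty_fintype A
  refine ⟨BernoulliShift.isWeaklyMixing_of_conservative hns hδ, fun p _ hcons => ?_⟩
  -- The `p`-th power of the shift on `A^ℤ` is the shift on `(A^p)^ℤ`, and its marginals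
  -- `μ n ⊗ ⋯ ⊗ μ n` have atoms of mass at least `δ ^ p` for `n > 0`.
  have he := measurePreserving_flipEquiv μ p
  have hconj : ∀ x, flipEquiv A p (cartesianPower p (leftShift A) x) =
      leftShift (Fin p → A) (flipEquiv A p x) := fun _ => rfl
  have hns' := (isNonsingular_congr he hconj).1 (isNonsingular_cartesianPower hns p)
  refine isWeaklyMixing_of_conj he hconj (BernoulliShift.isWeaklyMixing_of_conservative hns' ?_
    (conservative_of_conj he hconj hcons hns'))
  refine (ENNReal.pow_pos hδ p).trans_le ?_
  refine le_iInf₂ fun n hn => le_iInf fun a => ?_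
  rw [Measure.pi_singleton]
  calc _ = ∏ _i : Fin p, ⨅ (n : ℤ) (_ : 0 < n) (a : A), μ n {a} := by simp
    _ ≤ ∏ i, μ n {a i} :=
      Finset.prod_le_prod' fun i _ => (iInf₂_le n hn).trans (iInf_le _ (a i))
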